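/- There are absolute constants $C, c > 0$ such that the following holds. Let $p \geq 2$ and $\epsilon \in (0,1)$ be real numbers, let $G$ be a finite abelian group, and let $A$, $B$, $S$ be non-empty subsets of $G$ with $|A+S| \leq K_1|A|$ and $|A+B| \leq K_2|B|$, where $K_1, K_2$ are real numbers. Write $\mu_G(X) = |X|/|G|$ for $X \subset G$, and put $$\delta = c\,\epsilon\,\sqrt{\mu_G(A)/\mu_G(B)}\;K_2^{-1/p}, \qquad d = C p\,(\log(1/\delta))^2\,\epsilon^{-2}\log(2K_1) + C\log(\mu_G(S)^{-1}).$$ Then there are a set $\Gamma$ of at most $d$ characters $\gamma : G \to \mathbb{C}^\times$ and a real number $\rho \geq 0$ with $\rho \geq \delta/d$ such that every element $t$ of the Bohr set $$T = \{x \in G : |\gamma(x) - 1| \leq \rho \text{ for all } \gamma \in \Gamma\}$$ of rank $|\Gamma|$ and radius $\rho$ satisfies $$\|\mu_A * 1_B(x+t) - \mu_A * 1_B(x)\|_{L^p(x)} \leq \epsilon\, \mu_G(B)^{1/p}.$$ (If $d = 0$, then $\Gamma$ is empty and $T = G$ whatever the radius, and the condition $\rho \geq \delta/d$ is dropped.)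 Here $1_B$ is the indicator function of $B$, $\mu_A = 1_A/\mu_G(A)$, $f * g(x) = \frac{1}{|G|}\sum_{y \in G} f(y) g(x-y)$ and $\|f\|_{L^p} = \bigl(\frac{1}{|G|}\sum_{x \in G} |f(x)|^p\bigr)^{1/p}$. -/

import Mathlib

open scoped Pointwise BigOperators

noncomputable section

namespace AlmostPeriod

variable {G : Type*} [AddCommGroup G] [Fintype G]

/-- The normalized counting measure `μ_G(A) = |A| / |G|`. -/
def muG (A : Finset G) : ℝ := (A.card : ℝ) / (Fintype.card G : ℝ)

/-- The indicator function `1_A`, with complex values. -/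
def ind (A : Finset G) : G → ℂ := Set.indicator (A : Set G) 1

/-- The normalized indicator function `μ_A = 1_A / μ_G(A)` of a non-empty set `A`. -/
def muInd (A : Finset G) : G → ℂ := fun x => ind A x / (muG A : ℂ)

/-- The convolution `f * g (x) = 𝔼_y f(y) g(x - y)`, the average being over all of `G`. -/
def conv (f g : G → ℂ) : G → ℂ :=
  fun x => (∑ y : G, f y * g (x - y)) / (Fintype.card G : ℂ)

/-- The norm `‖f‖_{L^p} = (𝔼_x |f(x)|^p)^{1/p}`, the average being over all of `G`. -/
def lpNorm (p : ℝ) (f : G → ℂ) : ℝ :=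
  ((∑ x : G, ‖f x‖ ^ p) / (Fintype.card G : ℝ)) ^ (1 / p)

/-- The Bohr set `{x ∈ G : |γ(x) - 1| ≤ ρ for all γ ∈ Γ}` with frequency set `Γ` and radius `ρ`.
Its rank is `|Γ|`. The dual group of the finite group `G` is `AddChar G ℂ`. -/
def bohrSet (Γ : Finset (AddChar G ℂ)) (ρ : ℝ) : Set G :=
  {x | ∀ γ ∈ Γ, ‖γ x - 1‖ ≤ ρ}

end AlmostPeriod

end

set_option linter.unusedSectionVars false

open scoped Pointwise BigOperators

noncomputable section

namespace AlmostPeriod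

variable {G : Type*} [AddCommGroup G] [Fintype G]

/-! ### The `L^p` norm -/

/-! Write F = μ_A * 1_B. By Croot–Sisask sampling, for at least half of the tuples in A^n, n ≈
32p/η², the mean of the n translates of 1_B is within η μ(B)^{1/p} of F in L^p. Shifting a tuple by
s ∈ S lands in (A+S)^n, so pigeonholing gives T ⊆ S with |T| ≥ |S|/(2K₁^n) whose differences are
almost-periods of F (`exists_almost_periods`).

Average F over T - T k times, with k ≈ log(1/δ) and η = ε/(6k). The result U is within (ε/3)
μ(B)^{1/p} of F, and its Fourier coefficients carry a factor |mean of γ over T|^{2k}, which is at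
most δ off the large spectrum of T. By Chang's theorem (`exists_finset_spectrum`) that spectrum lies
in the {-1,0,1}-span of at most 8 log(1/μ(T)) characters, so a translation by an element of their
Bohr set moves U by at most 3δ √(μ(B)/μ(A)) uniformly. As F lives on A+B, only a set of measure at
most 2K₂μ(B) matters, which turns the uniform bound into an L^p bound
(`lpNorm_translate_sub_le_of_bohr`). If δ ≥ 1/2, then F itself is small and every t works. -/

lemma lpNorm_nonneg (p : ℝ) (f : G → ℂ) : 0 ≤ lpNorm p f := by
  unfold lpNorm; positivity

lemma lpNorm_mono {p : ℝ} (hp : 0 < p) {f g : G → ℂ} (h : ∀ x, ‖f x‖ ≤ ‖g x‖) :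
    lpNorm p f ≤ lpNorm p g := by
  unfold lpNorm
  gcongr with x
  exact h x

lemma lpNorm_congr_norm (p : ℝ) {f g : G → ℂ} (h : ∀ x, ‖f x‖ = ‖g x‖) :
    lpNorm p f = lpNorm p g := by
  simp only [lpNorm, h]

lemma lpNorm_add_le {p : ℝ} (hp : 1 ≤ p) (f g : G → ℂ) :
    lpNorm p (fun x => f x + g x) ≤ lpNorm p f + lpNorm p g := by
  have hp0 : 0 < p := by linarith
  unfold lpNorm
  rw [Real.div_rpow (by positivity) (by positivity), Real.div_rpow (by positivity) (by positivity),
    Real.div_rpow (by positivity) (by positivity), ← add_div]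
  gcongr
  refine le_trans ?_ (Real.Lp_add_le_of_nonneg (s := Finset.univ) (f := fun x => ‖f x‖)
    (g := fun x => ‖g x‖) hp (fun _ _ => norm_nonneg _) (fun _ _ => norm_nonneg _))
  gcongr with x
  exact norm_add_le _ _

lemma lpNorm_sum_le {ι : Type*} {p : ℝ} (hp : 1 ≤ p) (s : Finset ι) (f : ι → G → ℂ) :
    lpNorm p (fun x => ∑ i ∈ s, f i x) ≤ ∑ i ∈ s, lpNorm p (f i) := by
  classical
  induction s using Finset.induction_on with
  | empty =>
    have hp0 : p ≠ 0 := by linarith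
    simp [lpNorm, Real.zero_rpow hp0, Real.zero_rpow (inv_ne_zero hp0)]
  | insert i s hi ih =>
    simp only [Finset.sum_insert hi]
    exact (lpNorm_add_le hp _ _).trans (by gcongr)

lemma lpNorm_const_mul {p : ℝ} (hp : 0 < p) (c : ℂ) (f : G → ℂ) :
    lpNorm p (fun x => c * f x) = ‖c‖ * lpNorm p f := by
  unfold lpNorm
  simp only [norm_mul]
  simp_rw [Real.mul_rpow (norm_nonneg c) (norm_nonneg _)]
  rw [← Finset.mul_sum, mul_div_assoc, Real.mul_rpow (by positivity) (by positivity),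
    ← Real.rpow_mul (norm_nonneg c), mul_one_div_cancel hp.ne', Real.rpow_one]

lemma lpNorm_translate (p : ℝ) (t : G) (f : G → ℂ) :
    lpNorm p (fun x => f (x + t)) = lpNorm p f := by
  unfold lpNorm
  congr 2
  exact Equiv.sum_comp (Equiv.addRight t) (fun x => ‖f x‖ ^ p)

lemma lpNorm_sub_rev (p : ℝ) (f g : G → ℂ) :
    lpNorm p (fun x => f x - g x) = lpNorm p (fun x => g x - f x) :=
  lpNorm_congr_norm p fun _ => norm_sub_rev _ _

lemma lpNorm_sub_le {p : ℝ} (hp : 1 ≤ p) (f g h : G → ℂ) :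
    lpNorm p (fun x => f x - h x) ≤
      lpNorm p (fun x => f x - g x) + lpNorm p (fun x => g x - h x) := by
  simpa using lpNorm_add_le hp (fun x => f x - g x) (fun x => g x - h x)

/-- A bounded function supported on a small set has small `L^p` norm. -/
lemma lpNorm_le_of_support {p : ℝ} (hp : 0 < p) {f : G → ℂ} (E : Finset G) {M : ℝ} (hM : 0 ≤ M)
    (hf : ∀ x ∈ E, ‖f x‖ ≤ M) (hE : ∀ x ∉ E, f x = 0) :
    lpNorm p f ≤ M * muG E ^ (1 / p) := by
  have h1 : (∑ x, ‖f x‖ ^ p) ≤ M ^ p * E.card := by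
    rw [← Finset.sum_subset (Finset.subset_univ E)]
    · calc (∑ x ∈ E, ‖f x‖ ^ p) ≤ ∑ x ∈ E, M ^ p := by
            gcongr with x hx; exact hf x hx
        _ = _ := by simp [mul_comm]
    · intro x _ hx
      simp [hE x hx, Real.zero_rpow hp.ne']
  unfold lpNorm muG
  calc _ ≤ (M ^ p * E.card / (Fintype.card G : ℝ)) ^ (1 / p) := by gcongr
    _ = _ := by
      rw [mul_div_assoc, Real.mul_rpow (by positivity) (by positivity),
        ← Real.rpow_mul hM, mul_one_div_cancel hp.ne', Real.rpow_one]

/-! ### Smoothing by the differences of a set -/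

/-- The average of the translates of `h` by the differences of elements of `T`. -/
def smooth (T : Finset G) (h : G → ℂ) : G → ℂ :=
  fun x => ((T.card : ℂ) ^ 2)⁻¹ * ∑ s ∈ T, ∑ t ∈ T, h (x + (s - t))

/-- Minkowski's inequality for an average of translates. The target `g` is kept free: `g = 0` gives
contraction, `g = h` gives the cost of one smoothing. -/
lemma lpNorm_smooth_sub_le {p : ℝ} (hp : 1 ≤ p) {T : Finset G} (hT : T.Nonempty) (h g : G → ℂ)
    {M : ℝ} (hM : ∀ s ∈ T, ∀ t ∈ T, lpNorm p (fun x => h (x + (s - t)) - g x) ≤ M) :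
    lpNorm p (fun x => smooth T h x - g x) ≤ M := by
  have hc : (T.card : ℂ) ≠ 0 := by exact_mod_cast hT.card_pos.ne'
  have hc' : (T.card : ℝ) ≠ 0 := by exact_mod_cast hT.card_pos.ne'
  have e : (fun x => smooth T h x - g x) =
      fun x => ((T.card : ℂ) ^ 2)⁻¹ * ∑ s ∈ T, ∑ t ∈ T, (h (x + (s - t)) - g x) := by
    funext x
    simp only [smooth, Finset.sum_sub_distrib, Finset.sum_const, nsmul_eq_mul, mul_sub]
    field_simp
  rw [e, lpNorm_const_mul (by linarith)]
  calc _ ≤ ‖((T.card : ℂ) ^ 2)⁻¹‖ * ∑ s ∈ T, ∑ t ∈ T, M := by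
        gcongr
        refine (lpNorm_sum_le hp _ _).trans ?_
        gcongr with s hs
        refine (lpNorm_sum_le hp _ _).trans ?_
        gcongr with t ht
        exact hM s hs t ht
    _ = M := by
        simp only [Finset.sum_const, nsmul_eq_mul, norm_inv, norm_pow, Complex.norm_natCast]
        field_simp

lemma smooth_sub (T : Finset G) (f g : G → ℂ) :
    smooth T (fun x => f x - g x) = fun x => smooth T f x - smooth T g x := by
  funext x
  simp [smooth, Finset.sum_sub_distrib, mul_sub]

lemma lpNorm_smooth_le {p : ℝ} (hp : 1 ≤ p) {T : Finset G} (hT : T.Nonempty) (h : G → ℂ) :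
    lpNorm p (smooth T h) ≤ lpNorm p h := by
  have := lpNorm_smooth_sub_le hp hT h (fun _ => 0) (M := lpNorm p h) fun s _ t _ => by
    simpa using (lpNorm_translate p (s - t) h).le
  simpa using this

/-- Each further smoothing contracts the error made so far and adds at most `η`. -/
lemma lpNorm_smooth_iterate_sub_le {p : ℝ} (hp : 1 ≤ p) {T : Finset G} (hT : T.Nonempty)
    (f : G → ℂ) {η : ℝ}
    (hη : ∀ s ∈ T, ∀ t ∈ T, lpNorm p (fun x => f (x + (s - t)) - f x) ≤ η) (k : ℕ) :
    lpNorm p (fun x => (smooth T)^[k] f x - f x) ≤ k * η := by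
  induction k with
  | zero =>
    have hp0 : p ≠ 0 := by linarith
    simp [lpNorm, Real.zero_rpow hp0, Real.zero_rpow (inv_ne_zero hp0)]
  | succ k ih =>
    rw [Function.iterate_succ_apply']
    refine (lpNorm_sub_le hp _ (smooth T f) _).trans ?_
    have h1 := lpNorm_smooth_sub_le hp hT f f hη
    have h2 := lpNorm_smooth_le hp hT (fun x => (smooth T)^[k] f x - f x)
    rw [smooth_sub] at h2
    push_cast
    linarith

/-! ### Fourier expansion -/

open ComplexConjugate

/-- The Fourier coefficient `𝔼_x f(x) conj(γ(x))`. -/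
def coef (f : G → ℂ) (γ : AddChar G ℂ) : ℂ := (∑ x, f x * conj (γ x)) / (Fintype.card G : ℂ)

/-- The average of a character over a finite set. -/
def charMean (T : Finset G) (γ : AddChar G ℂ) : ℂ := (∑ t ∈ T, γ t) / (T.card : ℂ)

lemma sum_coef_mul (f : G → ℂ) (x : G) : ∑ γ : AddChar G ℂ, coef f γ * γ x = f x := by
  classical
  have h : ∀ γ : AddChar G ℂ, coef f γ * γ x =
      ∑ y, f y / (Fintype.card G : ℂ) * γ (x - y) := by
    intro γ
    rw [coef, Finset.sum_div, Finset.sum_mul]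
    refine Finset.sum_congr rfl fun y _ => ?_
    rw [sub_eq_add_neg, AddChar.map_add_eq_mul, AddChar.map_neg_eq_conj]
    ring
  simp_rw [h]
  rw [Finset.sum_comm]
  simp_rw [← Finset.mul_sum, AddChar.sum_apply_eq_ite, sub_eq_zero]
  simp

lemma sum_norm_coef_sq (f : G → ℂ) :
    ∑ γ : AddChar G ℂ, ‖coef f γ‖ ^ 2 = (∑ x, ‖f x‖ ^ 2) / (Fintype.card G : ℝ) := by
  have key : ∑ γ : AddChar G ℂ, coef f γ * conj (coef f γ) =
      (∑ x, f x * conj (f x)) / (Fintype.card G : ℂ) := by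
    have h : ∀ γ : AddChar G ℂ, coef f γ * conj (coef f γ) =
        ∑ x, conj (f x) / (Fintype.card G : ℂ) * (coef f γ * γ x) := by
      intro γ
      have : conj (coef f γ) = (∑ x, conj (f x) * γ x) / (Fintype.card G : ℂ) := by
        simp [coef, map_sum]
      rw [this, Finset.sum_div, Finset.mul_sum]
      exact Finset.sum_congr rfl fun y _ => by ring
    simp_rw [h]
    rw [Finset.sum_comm]
    simp_rw [← Finset.mul_sum, sum_coef_mul]
    rw [Finset.sum_div]
    exact Finset.sum_congr rfl fun y _ => by ring
  simp_rw [Complex.mul_conj, Complex.normSq_eq_norm_sq] at key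
  exact_mod_cast key

lemma conv_eq_sum (f g : G → ℂ) (x : G) :
    conv f g x = ∑ γ : AddChar G ℂ, coef f γ * coef g γ * γ x := by
  have h : ∀ y, f y * g (x - y) =
      ∑ γ : AddChar G ℂ, f y * conj (γ y) * (coef g γ * γ x) := by
    intro y
    rw [← sum_coef_mul g (x - y), Finset.mul_sum]
    refine Finset.sum_congr rfl fun γ _ => ?_
    rw [sub_eq_add_neg, AddChar.map_add_eq_mul, AddChar.map_neg_eq_conj]
    ring
  simp_rw [conv, h]
  rw [Finset.sum_comm, Finset.sum_div]
  refine Finset.sum_congr rfl fun γ _ => ?_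
  rw [← Finset.sum_mul, coef, coef]
  ring

/-- Averaging over differences, rather than over `T`, makes the multiplier the square of a modulus,
hence real and non-negative. -/
lemma smooth_sum (T : Finset G) (a : AddChar G ℂ → ℂ) :
    smooth T (fun x => ∑ γ : AddChar G ℂ, a γ * γ x) =
      fun x => ∑ γ : AddChar G ℂ, (a γ * (‖charMean T γ‖ ^ 2 : ℝ)) * γ x := by
  funext x
  have h : ∀ γ : AddChar G ℂ, a γ * (‖charMean T γ‖ ^ 2 : ℝ) * γ x =
      ((T.card : ℂ) ^ 2)⁻¹ * ∑ s ∈ T, ∑ t ∈ T, a γ * γ (x + (s - t)) := by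
    intro γ
    have h1 : ((‖charMean T γ‖ ^ 2 : ℝ) : ℂ) = charMean T γ * conj (charMean T γ) := by
      rw [Complex.mul_conj, Complex.normSq_eq_norm_sq]
    have h2 : ∑ s ∈ T, ∑ t ∈ T, a γ * γ (x + (s - t)) =
        a γ * γ x * ((∑ s ∈ T, γ s) * ∑ t ∈ T, conj (γ t)) := by
      rw [Finset.sum_mul_sum, Finset.mul_sum]
      refine Finset.sum_congr rfl fun s _ => ?_
      rw [Finset.mul_sum]
      refine Finset.sum_congr rfl fun t _ => ?_
      rw [sub_eq_add_neg, AddChar.map_add_eq_mul, AddChar.map_add_eq_mul, AddChar.map_neg_eq_conj]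
      ring
    rw [h1, h2, charMean, map_div₀, map_sum, Complex.conj_natCast]
    ring
  simp_rw [h]
  rw [smooth, ← Finset.mul_sum, Finset.sum_comm (s := Finset.univ)]
  exact congrArg _ (Finset.sum_congr rfl fun s _ => by
    rw [Finset.sum_comm (s := Finset.univ)])

lemma smooth_iterate_conv (T : Finset G) (f g : G → ℂ) (k : ℕ) :
    (smooth T)^[k] (conv f g) = fun x => ∑ γ : AddChar G ℂ,
      (coef f γ * coef g γ * ((‖charMean T γ‖ ^ 2) ^ k : ℝ)) * γ x := by
  induction k with
  | zero => funext x; simp [conv_eq_sum]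
  | succ k ih =>
    rw [Function.iterate_succ_apply', ih, smooth_sum]
    funext x
    refine Finset.sum_congr rfl fun γ _ => ?_
    push_cast
    ring

lemma norm_charMean_le (T : Finset G) (γ : AddChar G ℂ) : ‖charMean T γ‖ ≤ 1 := by
  rw [charMean, norm_div, Complex.norm_natCast]
  refine div_le_one_of_le₀ ((norm_sum_le _ _).trans ?_) (by positivity)
  simp [AddChar.norm_apply]

lemma sum_norm_ind_sq (B : Finset G) : ∑ x, ‖ind B x‖ ^ 2 = B.card := by
  classical
  simp [ind, Set.indicator_apply, apply_ite, Finset.sum_ite_mem]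

lemma muG_pos {A : Finset G} (hA : A.Nonempty) : 0 < muG A := by
  have := hA.card_pos
  unfold muG
  positivity

/-- Cauchy–Schwarz and Parseval; this is the origin of the square root in δ. -/
lemma sum_norm_coef_mul_le {A : Finset G} (hA : A.Nonempty) (B : Finset G) :
    ∑ γ : AddChar G ℂ, ‖coef (muInd A) γ * coef (ind B) γ‖ ≤ Real.sqrt (muG B / muG A) := by
  have hA' := muG_pos hA
  simp_rw [norm_mul]
  refine Real.le_sqrt_of_sq_le ((Finset.sum_mul_sq_le_sq_mul_sq _ _ _).trans (le_of_eq ?_))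
  rw [sum_norm_coef_sq, sum_norm_coef_sq, sum_norm_ind_sq]
  simp_rw [muInd, norm_div, div_pow]
  rw [← Finset.sum_div, sum_norm_ind_sq, Complex.norm_real, Real.norm_of_nonneg hA'.le]
  change _ / muG A ^ 2 / _ * muG B = _
  rw [div_right_comm]
  change muG A / muG A ^ 2 * muG B = _
  field_simp

/-- Translation by an element almost annihilated by the large spectrum of `T` hardly changes a
convolution that has been smoothed by `T`. -/
lemma norm_smooth_iterate_translate_sub_le {A : Finset G} (hA : A.Nonempty) (B T : Finset G)
    (k : ℕ) {η : ℝ} (hη : 0 ≤ η) {t : G}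
    (ht : ∀ γ : AddChar G ℂ, 1 / 2 ≤ ‖charMean T γ‖ → ‖γ t - 1‖ ≤ η) (x : G) :
    ‖(smooth T)^[k] (conv (muInd A) (ind B)) (x + t) -
      (smooth T)^[k] (conv (muInd A) (ind B)) x‖ ≤
      (η + 2 * (1 / 4) ^ k) * Real.sqrt (muG B / muG A) := by
  rw [smooth_iterate_conv]
  simp only
  rw [← Finset.sum_sub_distrib, mul_comm]
  refine (norm_sum_le _ _).trans ((?_ : _ ≤ _).trans
    (mul_le_mul_of_nonneg_right (sum_norm_coef_mul_le hA B) (by positivity)))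
  rw [Finset.sum_mul]
  refine Finset.sum_le_sum fun γ _ => ?_
  set c := coef (muInd A) γ * coef (ind B) γ
  have e : c * ((‖charMean T γ‖ ^ 2) ^ k : ℝ) * γ (x + t) - c * ((‖charMean T γ‖ ^ 2) ^ k : ℝ) * γ x
      = c * (((‖charMean T γ‖ ^ 2) ^ k : ℝ) * (γ t - 1) * γ x) := by
    rw [AddChar.map_add_eq_mul]; ring
  rw [e, norm_mul]
  gcongr
  rw [norm_mul, norm_mul, AddChar.norm_apply, mul_one, Complex.norm_real,
    Real.norm_of_nonneg (by positivity)]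
  -- On the large spectrum `γ t` is near 1; elsewhere the multiplier is at most `(1 / 4) ^ k` and
  -- `‖γ t - 1‖ ≤ 2` suffices.
  rcases le_or_gt (1 / 2) ‖charMean T γ‖ with h | h
  · have h1 : (‖charMean T γ‖ ^ 2) ^ k ≤ 1 :=
      pow_le_one₀ (by positivity) (pow_le_one₀ (by positivity) (norm_charMean_le T γ))
    have h2 := ht γ h
    have h3 : (0 : ℝ) ≤ 2 * (1 / 4) ^ k := by positivity
    nlinarith [norm_nonneg (γ t - 1)]
  · have h1 : (‖charMean T γ‖ ^ 2) ^ k ≤ (1 / 4) ^ k := by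
      gcongr
      nlinarith [norm_nonneg (charMean T γ)]
    have h2 : ‖γ t - 1‖ ≤ 2 := by
      refine (norm_sub_le _ _).trans ?_
      rw [AddChar.norm_apply]; norm_num
    have h4 : (‖charMean T γ‖ ^ 2) ^ k * ‖γ t - 1‖ ≤ (1 / 4) ^ k * 2 := by gcongr
    linarith

/-! ### Chang's theorem -/

/-- A dissociated set of characters with large mean on `T` is small. -/
lemma card_le_of_addDissociated {T : Finset G} (hT : T.Nonempty) {Λ : Finset (AddChar G ℂ)}
    (hΛ : AddDissociated (Λ : Set (AddChar G ℂ))) (h : ∀ γ ∈ Λ, 1 / 2 ≤ ‖charMean T γ‖) :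
    (Λ.card : ℝ) ≤ 8 * Real.log (muG T)⁻¹ := by
  classical
  have hT0 : (0 : ℝ) < T.card := by exact_mod_cast hT.card_pos
  have hG0 : (0 : ℝ) < Fintype.card G := by exact_mod_cast Fintype.card_pos
  -- unimodular multiples of the characters with real positive mean
  let u : AddChar G ℂ → ℂ := fun γ => conj (charMean T γ) / ‖charMean T γ‖
  have hpos : ∀ γ ∈ Λ, 0 < ‖charMean T γ‖ := fun γ hγ => by linarith [h γ hγ]
  have hu : ∀ γ ∈ Λ, ‖u γ‖ = 1 := fun γ hγ => by
    have := (hpos γ hγ).ne'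
    simp only [u, norm_div, RCLike.norm_conj, Complex.norm_real, norm_norm]
    exact div_self this
  let w : G → ℝ := fun x => ∑ γ ∈ Λ, (u γ * γ x).re
  have hmean : ∑ x ∈ T, w x = T.card * ∑ γ ∈ Λ, ‖charMean T γ‖ := by
    simp only [w]
    rw [Finset.sum_comm, Finset.mul_sum]
    refine Finset.sum_congr rfl fun γ hγ => ?_
    rw [← Complex.re_sum, ← Finset.mul_sum]
    have e : ∑ x ∈ T, γ x = T.card * charMean T γ := by
      have : (T.card : ℂ) ≠ 0 := by exact_mod_cast hT0.ne'
      rw [charMean]; field_simp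
    have e2 : u γ * (T.card * charMean T γ) = ((T.card * ‖charMean T γ‖ : ℝ) : ℂ) := by
      have h0 : ((‖charMean T γ‖ : ℝ) : ℂ) ≠ 0 := by exact_mod_cast (hpos γ hγ).ne'
      have h1 := Complex.mul_conj (charMean T γ)
      rw [Complex.normSq_eq_norm_sq] at h1
      simp only [u]
      push_cast at h1 ⊢
      field_simp
      linear_combination (T.card : ℂ) * h1
    rw [e, e2, Complex.ofReal_re]
  -- Riesz product
  have hprod : ∑ x, Real.exp (w x / 2) ≤
      Fintype.card G * Real.exp (Λ.card / 8) := by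
    -- With `exp (θ w)`, Jensen on `T` will give θ|Λ|/2 in the exponent and the Riesz product
    -- θ²|Λ|/2. The gap is largest at θ = 1/2, where it equals |Λ|/8: hence the constant 8.
    let c : AddChar G ℂ → ℝ := fun γ => if γ ∈ Λ then Real.cosh (1 / 2) else 1
    let d : AddChar G ℂ → ℂ := fun γ => if γ ∈ Λ then (Real.sinh (1 / 2) : ℝ) * u γ else 0
    have hd : AddDissociated {ψ | d ψ ≠ 0} := hΛ.subset fun ψ hψ => by
      by_contra hn
      exact hψ (if_neg hn)
    -- Dissociativity makes every non-constant term of the expanded product average to zero.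
    have hr := AddDissociated.randomisation c d hd
    have e1 : ∏ ψ, c ψ = Real.cosh (1 / 2) ^ Λ.card := by
      simp only [c]
      rw [Finset.prod_ite_mem]
      simp
    have e2 : ∀ x, ∏ ψ, (c ψ + (d ψ * ψ x).re) =
        ∏ ψ ∈ Λ, (Real.cosh (1 / 2) + Real.sinh (1 / 2) * (u ψ * ψ x).re) := by
      intro x
      rw [← Finset.prod_subset (Finset.subset_univ Λ)]
      · refine Finset.prod_congr rfl fun ψ hψ => ?_
        simp only [c, d, if_pos hψ, mul_assoc, Complex.re_ofReal_mul]
      · intro ψ _ hψ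
        simp [c, d, hψ]
    have e3 : ∀ x, Real.exp (w x / 2) ≤ ∏ ψ, (c ψ + (d ψ * ψ x).re) := by
      intro x
      rw [e2]
      simp only [w]
      rw [Finset.sum_div, Real.exp_sum]
      refine Finset.prod_le_prod (fun _ _ => (Real.exp_pos _).le) fun ψ hψ => ?_
      have hb : |(u ψ * ψ x).re| ≤ 1 := by
        refine (Complex.abs_re_le_norm _).trans ?_
        rw [norm_mul, hu ψ hψ, AddChar.norm_apply, mul_one]
      obtain ⟨hb1, hb2⟩ := abs_le.1 hb
      set y := (u ψ * ψ x).re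
      -- On [-1/2, 1/2] the exponential lies below its chord, which is the affine factor of the
      -- Riesz product.
      have hc := (convexOn_exp).2 (Set.mem_univ (1 / 2 : ℝ)) (Set.mem_univ (-(1 / 2) : ℝ))
        (show (0 : ℝ) ≤ (1 + y) / 2 by linarith) (show (0 : ℝ) ≤ (1 - y) / 2 by linarith) (by ring)
      simp only [smul_eq_mul] at hc
      rw [show (1 + y) / 2 * (1 / 2) + (1 - y) / 2 * -(1 / 2) = y / 2 by ring] at hc
      refine hc.trans (le_of_eq ?_)
      rw [Real.cosh_eq, Real.sinh_eq]
      ring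
    rw [Fintype.expect_eq_sum_div_card, e1, div_eq_iff hG0.ne'] at hr
    calc _ ≤ ∑ x, ∏ ψ, (c ψ + (d ψ * ψ x).re) := Finset.sum_le_sum fun x _ => e3 x
      _ = Fintype.card G * Real.cosh (1 / 2) ^ Λ.card := by rw [hr, mul_comm]
      _ ≤ Fintype.card G * Real.exp ((1 / 2) ^ 2 / 2) ^ Λ.card := by
        gcongr
        exact Real.cosh_le_exp_half_sq _
      _ = _ := by
        rw [← Real.exp_nat_mul]
        congr 2
        ring
  -- Jensen
  have hJ : T.card * Real.exp (Λ.card / 4) ≤ ∑ x ∈ T, Real.exp (w x / 2) := by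
    have hj := convexOn_exp.map_sum_le (t := T) (w := fun _ => (T.card : ℝ)⁻¹)
      (p := fun x => w x / 2) (fun _ _ => by positivity)
      (by simp [hT0.ne']) (fun _ _ => Set.mem_univ _)
    simp only [smul_eq_mul, ← Finset.mul_sum, ← Finset.sum_div] at hj
    rw [hmean] at hj
    have hs : (Λ.card : ℝ) / 4 ≤ (T.card : ℝ)⁻¹ * (T.card * (∑ γ ∈ Λ, ‖charMean T γ‖) / 2) := by
      have : ∑ γ ∈ Λ, (1 / 2 : ℝ) ≤ ∑ γ ∈ Λ, ‖charMean T γ‖ := Finset.sum_le_sum h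
      simp only [Finset.sum_const, nsmul_eq_mul] at this
      field_simp
      linarith
    have := (Real.exp_le_exp.2 hs).trans hj
    rwa [inv_mul_eq_div, le_div_iff₀ hT0, mul_comm] at this
  have hfin : Real.exp (Λ.card / 8) ≤ (muG T)⁻¹ := by
    have h1 : ∑ x ∈ T, Real.exp (w x / 2) ≤ ∑ x, Real.exp (w x / 2) :=
      Finset.sum_le_sum_of_subset_of_nonneg (Finset.subset_univ _)
        fun _ _ _ => (Real.exp_pos _).le
    have h2 := (hJ.trans h1).trans hprod
    rw [show (Λ.card : ℝ) / 4 = Λ.card / 8 + Λ.card / 8 by ring, Real.exp_add, ← mul_assoc] at h2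
    have h3 := le_of_mul_le_mul_right h2 (Real.exp_pos _)
    rw [muG, inv_div, le_div_iff₀ hT0]
    linarith
  have := (Real.le_log_iff_exp_le (inv_pos.2 (muG_pos hT))).2 hfin
  linarith

lemma norm_prod_sub_one_le {ι : Type*} (s : Finset ι) (z : ι → ℂ) (hz : ∀ i ∈ s, ‖z i‖ ≤ 1)
    {ρ : ℝ} (h : ∀ i ∈ s, ‖z i - 1‖ ≤ ρ) : ‖∏ i ∈ s, z i - 1‖ ≤ s.card * ρ := by
  classical
  induction s using Finset.induction_on with
  | empty => simp
  | insert i s hi ih =>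
    rw [Finset.prod_insert hi, Finset.card_insert_of_notMem hi]
    have h1 := ih (fun j hj => hz j (Finset.mem_insert_of_mem hj))
      (fun j hj => h j (Finset.mem_insert_of_mem hj))
    have h2 := h i (Finset.mem_insert_self _ _)
    have h3 := hz i (Finset.mem_insert_self _ _)
    calc ‖z i * ∏ j ∈ s, z j - 1‖ = ‖z i * (∏ j ∈ s, z j - 1) + (z i - 1)‖ := by ring_nf
      _ ≤ ‖z i‖ * ‖∏ j ∈ s, z j - 1‖ + ‖z i - 1‖ := by
        rw [← norm_mul]; exact norm_add_le _ _
      _ ≤ 1 * (s.card * ρ) + ρ := by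
        gcongr
      _ = _ := by push_cast; ring

/-- The large spectrum of `T` is controlled by few characters. -/
lemma exists_finset_spectrum {T : Finset G} (hT : T.Nonempty) :
    ∃ Γ : Finset (AddChar G ℂ), (Γ.card : ℝ) ≤ 8 * Real.log (muG T)⁻¹ ∧
      ∀ ρ : ℝ, ∀ t ∈ bohrSet Γ ρ, ∀ γ : AddChar G ℂ, 1 / 2 ≤ ‖charMean T γ‖ →
        ‖γ t - 1‖ ≤ Γ.card * ρ := by
  classical
  have hμ : 0 ≤ 8 * Real.log (muG T)⁻¹ := by
    simpa using card_le_of_addDissociated hT (Λ := ∅) (by simp) (by simp)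
  -- Bounding all dissociated subsets of the spectrum bounds a set spanning it with coefficients -1,
  -- 0, 1.
  obtain ⟨Γ, hΓ, hcard, hspan⟩ := Finset.exists_subset_addSpan_card_le_of_forall_addDissociated
    (s := ({γ | 1 / 2 ≤ ‖charMean T γ‖} : Finset (AddChar G ℂ)))
    (d := ⌊8 * Real.log (muG T)⁻¹⌋₊) fun Λ hΛ hd => Nat.le_floor
      (card_le_of_addDissociated hT hd fun γ hγ => by simpa using hΛ hγ)
  refine ⟨Γ, (Nat.le_floor_iff hμ).1 hcard, fun ρ t ht γ hγ => ?_⟩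
  obtain ⟨e, he, rfl⟩ := Finset.mem_addSpan.1 (hspan (by simpa using hγ))
  rw [AddChar.sum_apply]
  refine norm_prod_sub_one_le _ _ (fun ψ _ => (AddChar.norm_apply _ _).le) fun ψ hψ => ?_
  have h1 := ht ψ hψ
  rcases he ψ with h | h | h
  · rw [h, neg_one_zsmul, AddChar.neg_apply, AddChar.map_neg_eq_conj, ← map_one conj, ← map_sub,
      RCLike.norm_conj]
    exact h1
  · rw [h, zero_zsmul]
    simpa using (norm_nonneg _).trans h1
  · rwa [h, one_zsmul]

/-! ### Random sampling -/

/-- The `- 2` removes the constant term of `2 cosh x`, so that the moment bound derived from this is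
proportional to the variance. For `x ≤ 1` compare with `x ^ 2`; for `x ≥ 1` use `x / p ≤ exp (x / p
- 1)`. -/
lemma rpow_le_exp_add_exp_neg {p x : ℝ} (hp : 2 ≤ p) (hx : 0 ≤ x) :
    x ^ p ≤ p ^ p * (Real.exp x + Real.exp (-x) - 2) := by
  have hp0 : 0 < p := by linarith
  have hpp : 1 ≤ p ^ p := Real.one_le_rpow (by linarith) hp0.le
  rcases le_total x 1 with h | h
  · have h1 : x ^ p ≤ x ^ 2 := by
      rw [← Real.rpow_two]
      rcases hx.eq_or_lt with rfl | hx
      · simp [Real.zero_rpow hp0.ne']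
      · exact Real.rpow_le_rpow_of_exponent_ge hx h hp
    have h2 : x ^ 2 ≤ Real.exp x + Real.exp (-x) - 2 := by
      have h3 := Real.self_le_sinh_iff.2 (show 0 ≤ x / 2 by linarith)
      have h4 : Real.exp x + Real.exp (-x) - 2 = (2 * Real.sinh (x / 2)) ^ 2 := by
        have e1 : Real.exp x = Real.exp (x / 2) ^ 2 := by
          rw [← Real.exp_nat_mul]; congr 1; push_cast; ring
        have e2 : Real.exp (-x) = Real.exp (-(x / 2)) ^ 2 := by
          rw [← Real.exp_nat_mul]; congr 1; push_cast; ring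
        have e3 : Real.exp (x / 2) * Real.exp (-(x / 2)) = 1 := by
          rw [← Real.exp_add]; simp
        rw [Real.sinh_eq, e1, e2]
        linear_combination 2 * e3
      rw [h4]
      nlinarith
    nlinarith [sq_nonneg x]
  · have h1 : x / p ≤ Real.exp (x / p - 1) := by
      have := Real.add_one_le_exp (x / p - 1); linarith
    have h2 : (x / p) ^ p ≤ Real.exp (x - p) := by
      calc (x / p) ^ p ≤ Real.exp (x / p - 1) ^ p := by gcongr
        _ = _ := by
          rw [← Real.exp_mul]; congr 1; field_simp
    rw [Real.div_rpow hx hp0.le, div_le_iff₀ (by positivity), mul_comm] at h2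
    refine h2.trans ?_
    gcongr
    have h3 : Real.exp (x - p) ≤ Real.exp x * Real.exp (-2) := by
      rw [← Real.exp_add]; gcongr; linarith
    have h4 : Real.exp (-2) ≤ 1 / 7 := by
      rw [Real.exp_neg, inv_eq_one_div]
      gcongr
      have : Real.exp 2 = Real.exp 1 ^ 2 := by
        rw [← Real.exp_nat_mul]; norm_num
      rw [this]
      nlinarith [Real.exp_one_gt_d9]
    have h5 : 2.7 ≤ Real.exp x := by
      have := Real.exp_le_exp.2 h
      linarith [Real.exp_one_gt_d9]
    nlinarith [Real.exp_pos (-x)]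

lemma sum_exp_le {α : Type*} {A : Finset α} {X : α → ℝ} {q s : ℝ}
    (hX : ∀ a ∈ A, |X a| ≤ 1) (h0 : ∑ a ∈ A, X a = 0) (h2 : ∑ a ∈ A, X a ^ 2 ≤ A.card * q)
    (hs : |s| ≤ 1) : ∑ a ∈ A, Real.exp (s * X a) ≤ A.card * Real.exp (s ^ 2 * q) := by
  have h : ∀ a ∈ A, Real.exp (s * X a) ≤ 1 + s * X a + s ^ 2 * X a ^ 2 := by
    intro a ha
    have h1 : |s * X a| ≤ 1 := by
      rw [abs_mul]; exact mul_le_one₀ hs (abs_nonneg _) (hX a ha)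
    have h3 := (abs_le.1 (Real.abs_exp_sub_one_sub_id_le h1)).2
    rw [mul_pow] at h3
    linarith
  calc _ ≤ ∑ a ∈ A, (1 + s * X a + s ^ 2 * X a ^ 2) := Finset.sum_le_sum h
    _ = A.card + s ^ 2 * ∑ a ∈ A, X a ^ 2 := by
      rw [Finset.sum_add_distrib, Finset.sum_add_distrib, ← Finset.mul_sum, h0, ← Finset.mul_sum]
      simp
    _ ≤ A.card + s ^ 2 * (A.card * q) := by gcongr
    _ = A.card * (s ^ 2 * q + 1) := by ring
    _ ≤ _ := by gcongr; exact Real.add_one_le_exp _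

lemma sum_piFinset_exp_le {α : Type*} {A : Finset α} {X : α → ℝ} {q s : ℝ}
    (hX : ∀ a ∈ A, |X a| ≤ 1) (h0 : ∑ a ∈ A, X a = 0) (h2 : ∑ a ∈ A, X a ^ 2 ≤ A.card * q)
    (hs : |s| ≤ 1) (n : ℕ) :
    ∑ a ∈ Fintype.piFinset (fun _ : Fin n => A), Real.exp (s * ∑ i, X (a i)) ≤
      (A.card : ℝ) ^ n * Real.exp (n * s ^ 2 * q) := by
  simp_rw [Finset.mul_sum, Real.exp_sum]
  rw [← Finset.prod_univ_sum (fun _ : Fin n => A) (fun _ a => Real.exp (s * X a))]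
  simp only [Finset.prod_const, Finset.card_univ, Fintype.card_fin]
  calc _ ≤ (A.card * Real.exp (s ^ 2 * q)) ^ n := by
        gcongr
        exact sum_exp_le hX h0 h2 hs
    _ = _ := by
      rw [mul_pow, ← Real.exp_nat_mul]; ring_nf

/-- A moment bound for the average of `n` independent samples of a centred variable. -/
lemma sum_piFinset_rpow_le {α : Type*} {A : Finset α} {X : α → ℝ} {p q η : ℝ} {n : ℕ}
    (hX : ∀ a ∈ A, |X a| ≤ 1) (h0 : ∑ a ∈ A, X a = 0) (h2 : ∑ a ∈ A, X a ^ 2 ≤ A.card * q)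
    (hq0 : 0 ≤ q) (hq1 : q ≤ 1) (hp : 2 ≤ p) (hη0 : 0 < η) (hη1 : η ≤ 1)
    (hn : 32 * p / η ^ 2 ≤ n) :
    ∑ a ∈ Fintype.piFinset (fun _ : Fin n => A), |(∑ i, X (a i)) / n| ^ p ≤
      (A.card : ℝ) ^ n * (q * (η ^ p / 2)) := by
  have hp0 : 0 < p := by linarith
  have hn1 : 32 * p ≤ η ^ 2 * n := by
    rw [div_le_iff₀ (by positivity)] at hn; linarith
  have hn0 : (0 : ℝ) < n := lt_of_lt_of_le (by positivity) hn
  have hηsq : η ^ 2 ≤ 1 := pow_le_one₀ hη0.le hη1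
  have hpn : p ≤ n := by nlinarith
  -- This choice gives `n * s ^ 2 = p`, so the exponential moment is `exp (p * q)`, and `p / (n * s)
  -- = s`; the 32 in `hn` makes `s * e ≤ η / 2`.
  set s := Real.sqrt (p / n) with hs
  have hs0 : 0 < s := Real.sqrt_pos.2 (by positivity)
  have hsq : s ^ 2 = p / n := Real.sq_sqrt (by positivity)
  have hs1 : s ≤ 1 := Real.sqrt_le_one.2 (div_le_one_of_le₀ hpn hn0.le)
  have hnsq : n * s ^ 2 = p := by rw [hsq]; field_simp
  have hsη : p / (n * s) * Real.exp 1 ≤ η / 2 := by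
    have e1 : p / (n * s) = s := by
      rw [div_eq_iff (by positivity)]; linarith
    rw [e1]
    refine abs_le_of_sq_le_sq' ?_ (by positivity) |>.2
    rw [mul_pow, hsq, div_mul_eq_mul_div, div_le_iff₀ hn0]
    have h3 : Real.exp 1 ^ 2 ≤ 8 := by
      nlinarith [Real.exp_one_lt_d9, Real.exp_one_gt_d9]
    nlinarith
  have hpoint : ∀ y : ℝ, |y / n| ^ p ≤ (p / (n * s)) ^ p *
      (Real.exp (s * y) + Real.exp (-s * y) - 2) := by
    intro y
    have h3 := rpow_le_exp_add_exp_neg hp (abs_nonneg (s * y))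
    have h4 : Real.exp |s * y| + Real.exp (-|s * y|) = Real.exp (s * y) + Real.exp (-s * y) := by
      rcases abs_choice (s * y) with h | h <;> rw [h]
      · rw [neg_mul]
      · rw [neg_neg, neg_mul, add_comm]
    rw [h4] at h3
    have h5 : |y / n| = |s * y| / (n * s) := by
      rw [abs_div, abs_mul, abs_of_pos hs0, abs_of_pos hn0]; field_simp
    rw [h5, Real.div_rpow (abs_nonneg _) (by positivity), Real.div_rpow hp0.le (by positivity),
      div_mul_eq_mul_div]
    gcongr
  -- Convexity between 0 and `p` extracts the factor `q`.
  have hexp : Real.exp (p * q) - 1 ≤ q * Real.exp p := by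
    have h3 := (convexOn_exp).2 (Set.mem_univ p) (Set.mem_univ 0) hq0
      (show (0 : ℝ) ≤ 1 - q by linarith) (by ring)
    simp only [smul_eq_mul, mul_zero, add_zero, Real.exp_zero, mul_one] at h3
    rw [mul_comm]
    linarith
  have hm1 := sum_piFinset_exp_le hX h0 h2 (s := s) (by rwa [abs_of_pos hs0]) n
  have hm2 := sum_piFinset_exp_le hX h0 h2 (s := -s) (by rwa [abs_neg, abs_of_pos hs0]) n
  rw [neg_sq] at hm2
  rw [hnsq] at hm1 hm2
  calc _ ≤ ∑ a ∈ Fintype.piFinset (fun _ : Fin n => A), (p / (n * s)) ^ p *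
        (Real.exp (s * ∑ i, X (a i)) + Real.exp (-s * ∑ i, X (a i)) - 2) :=
        Finset.sum_le_sum fun a _ => hpoint _
    _ ≤ (p / (n * s)) ^ p * ((A.card : ℝ) ^ n * (2 * (q * Real.exp p))) := by
      rw [← Finset.mul_sum, Finset.sum_sub_distrib, Finset.sum_add_distrib]
      gcongr
      simp only [Finset.sum_const, nsmul_eq_mul, Fintype.card_piFinset_const, Nat.cast_pow]
      have : (0 : ℝ) ≤ (A.card : ℝ) ^ n := by positivity
      nlinarith
    _ = (A.card : ℝ) ^ n * (2 * q * (p / (n * s) * Real.exp 1) ^ p) := by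
      rw [Real.mul_rpow (by positivity) (by positivity), ← Real.exp_mul, one_mul]
      ring
    _ ≤ (A.card : ℝ) ^ n * (2 * q * (η / 2) ^ p) := by gcongr
    _ ≤ _ := by
      rw [Real.div_rpow hη0.le (by norm_num)]
      have h3 : (4 : ℝ) ≤ 2 ^ p := by
        calc (4 : ℝ) = 2 ^ (2 : ℝ) := by norm_num
          _ ≤ 2 ^ p := by gcongr; norm_num
      have h4 : η ^ p / 2 ^ p ≤ η ^ p / 4 := by gcongr
      have h5 : 2 * q * (η ^ p / 2 ^ p) ≤ 2 * q * (η ^ p / 4) := by gcongr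
      refine mul_le_mul_of_nonneg_left ?_ (by positivity)
      linarith

lemma conv_muInd_apply {A : Finset G} (f : G → ℂ) (x : G) :
    conv (muInd A) f x = (∑ a ∈ A, f (x - a)) / A.card := by
  classical
  have hG : (Fintype.card G : ℂ) ≠ 0 := by exact_mod_cast Fintype.card_ne_zero
  have : ∀ y, muInd A y * f (x - y) = if y ∈ A then f (x - y) / (muG A : ℂ) else 0 := by
    intro y
    by_cases h : y ∈ A <;> simp [muInd, ind, h]
    ring
  simp_rw [conv, this]
  rw [Finset.sum_ite_mem, Finset.univ_inter, ← Finset.sum_div, div_div, muG]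
  push_cast
  rw [div_mul_cancel₀ _ hG]

/-- The average of the translates of `1_B` by the entries of a tuple. -/
def sampleMean {n : ℕ} (B : Finset G) (a : Fin n → G) : G → ℂ :=
  fun x => (∑ i, ind B (x - a i)) / n

/-- At each `x` the samples have mean q = F(x) and variance q - q² ≤ q. The moment bound is linear
in q, and q averages to μ(B) over `x`. -/
lemma sum_rpow_lpNorm_le {p η : ℝ} {n : ℕ} {A : Finset G} (hA : A.Nonempty) (B : Finset G)
    (hp : 2 ≤ p) (hη0 : 0 < η) (hη1 : η ≤ 1) (hn : 32 * p / η ^ 2 ≤ n) :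
    ∑ a ∈ Fintype.piFinset (fun _ : Fin n => A),
      lpNorm p (fun x => sampleMean B a x - conv (muInd A) (ind B) x) ^ p ≤
      (A.card : ℝ) ^ n * (muG B * (η ^ p / 2)) := by
  classical
  have hp0 : 0 < p := by linarith
  have hA0 : (0 : ℝ) < A.card := by exact_mod_cast hA.card_pos
  have hn0 : (0 : ℝ) < n := lt_of_lt_of_le (by positivity) hn
  let g : G → ℝ := fun x => if x ∈ B then 1 else 0
  have hg : ∀ x, ind B x = (g x : ℂ) := fun x => by
    by_cases h : x ∈ B <;> simp [ind, g, h]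
  let q : G → ℝ := fun x => (∑ a ∈ A, g (x - a)) / A.card
  have hg01 : ∀ x, 0 ≤ g x ∧ g x ≤ 1 ∧ g x ^ 2 = g x := fun x => by
    by_cases h : x ∈ B <;> simp [g, h]
  have hq0 : ∀ x, 0 ≤ q x := fun x =>
    div_nonneg (Finset.sum_nonneg fun a _ => (hg01 _).1) hA0.le
  have hq1 : ∀ x, q x ≤ 1 := fun x => by
    refine div_le_one_of_le₀ ?_ hA0.le
    calc _ ≤ ∑ a ∈ A, (1 : ℝ) := Finset.sum_le_sum fun a _ => (hg01 _).2.1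
      _ = _ := by simp
  have hqs : ∀ x, ∑ a ∈ A, g (x - a) = A.card * q x := fun x => by
    simp only [q]; field_simp
  have hnorm : ∀ (a : Fin n → G) (x : G),
      ‖sampleMean B a x - conv (muInd A) (ind B) x‖ = |(∑ i, (g (x - a i) - q x)) / n| := by
    intro a x
    rw [conv_muInd_apply, sampleMean]
    simp_rw [hg]
    rw [← Real.norm_eq_abs, ← Complex.norm_real]
    congr 1
    rw [Finset.sum_sub_distrib, sub_div]
    simp only [q, Finset.sum_const, Finset.card_univ, Fintype.card_fin, nsmul_eq_mul]
    rw [mul_div_cancel_left₀ _ hn0.ne']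
    push_cast
    rfl
  have hx : ∀ x, ∑ a ∈ Fintype.piFinset (fun _ : Fin n => A),
      ‖sampleMean B a x - conv (muInd A) (ind B) x‖ ^ p ≤
      (A.card : ℝ) ^ n * (q x * (η ^ p / 2)) := by
    intro x
    simp_rw [hnorm]
    refine sum_piFinset_rpow_le (X := fun a => g (x - a) - q x) ?_ ?_ ?_ (hq0 x) (hq1 x)
      hp hη0 hη1 hn
    · intro a _
      rw [abs_le]
      constructor <;> linarith [hg01 (x - a), hq0 x, hq1 x, (hg01 (x - a)).2.1]
    · rw [Finset.sum_sub_distrib, hqs]; simp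
    · have : ∀ a, (g (x - a) - q x) ^ 2 = g (x - a) - 2 * q x * g (x - a) + q x ^ 2 := fun a => by
        rw [sub_sq, (hg01 _).2.2]; ring
      simp_rw [this]
      rw [Finset.sum_add_distrib, Finset.sum_sub_distrib, ← Finset.mul_sum, hqs]
      simp only [Finset.sum_const, nsmul_eq_mul]
      nlinarith [mul_nonneg hA0.le (sq_nonneg (q x))]
  have hqsum : (∑ x, q x) / Fintype.card G = muG B := by
    have : ∑ x, q x = B.card := by
      simp only [q]
      rw [← Finset.sum_div, Finset.sum_comm]
      have : ∀ a ∈ A, ∑ x, g (x - a) = B.card := fun a _ => by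
        refine (Equiv.sum_comp (Equiv.subRight a) g).trans ?_
        simp [g]
      rw [Finset.sum_congr rfl this, Finset.sum_const, nsmul_eq_mul,
        mul_div_cancel_left₀ _ hA0.ne']
    rw [this, muG]
  have hlp : ∀ f : G → ℂ, lpNorm p f ^ p = (∑ x, ‖f x‖ ^ p) / Fintype.card G := fun f => by
    rw [lpNorm, ← Real.rpow_mul (by positivity), one_div_mul_cancel hp0.ne', Real.rpow_one]
  simp_rw [hlp]
  rw [← Finset.sum_div, Finset.sum_comm, ← hqsum]
  calc _ ≤ (∑ x, (A.card : ℝ) ^ n * (q x * (η ^ p / 2))) / Fintype.card G := by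
        gcongr with x; exact hx x
    _ = _ := by
      rw [← Finset.mul_sum, ← Finset.sum_mul]; ring

/-- At least half of all tuples sample the convolution well. -/
lemma card_pow_le_two_mul_card_filter {p η : ℝ} {n : ℕ} {A B : Finset G} (hA : A.Nonempty)
    (hB : B.Nonempty) (hp : 2 ≤ p) (hη0 : 0 < η) (hη1 : η ≤ 1) (hn : 32 * p / η ^ 2 ≤ n) :
    (A.card : ℝ) ^ n ≤ 2 * ((Fintype.piFinset (fun _ : Fin n => A)).filter fun a =>
      lpNorm p (fun x => sampleMean B a x - conv (muInd A) (ind B) x) ≤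
        η * muG B ^ (1 / p)).card := by
  classical
  have hp0 : 0 < p := by linarith
  have hB0 := muG_pos hB
  set P := Fintype.piFinset (fun _ : Fin n => A)
  set N : (Fin n → G) → ℝ := fun a =>
    lpNorm p (fun x => sampleMean B a x - conv (muInd A) (ind B) x) with hN
  have hsum : ∑ a ∈ P, N a ^ p ≤ _ := sum_rpow_lpNorm_le hA B hp hη0 hη1 hn
  have hcard := Finset.card_filter_add_card_filter_not (s := P) (fun a => N a ≤ η * muG B ^ (1 / p))
  have hP : P.card = A.card ^ n := by simp [P]
  -- Markov's inequality for the `p`-th powers.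
  have hbad : ((P.filter fun a => ¬ N a ≤ η * muG B ^ (1 / p)).card : ℝ) * (η ^ p * muG B) ≤
      ∑ a ∈ P, N a ^ p := by
    rw [← nsmul_eq_mul, ← Finset.sum_const]
    refine le_trans (Finset.sum_le_sum fun a ha => ?_)
      (Finset.sum_le_sum_of_subset_of_nonneg (Finset.filter_subset _ P)
        fun a _ _ => Real.rpow_nonneg (lpNorm_nonneg _ _) _)
    have h1 := (not_le.1 (Finset.mem_filter.1 ha).2).le
    calc η ^ p * muG B = (η * muG B ^ (1 / p)) ^ p := by
          rw [Real.mul_rpow hη0.le (by positivity), ← Real.rpow_mul hB0.le,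
            one_div_mul_cancel hp0.ne', Real.rpow_one]
      _ ≤ N a ^ p := by gcongr
  have h2 := hbad.trans hsum
  have h3 : (A.card : ℝ) ^ n * (muG B * (η ^ p / 2)) =
      ((A.card : ℝ) ^ n / 2) * (η ^ p * muG B) := by ring
  rw [h3] at h2
  have h4 := le_of_mul_le_mul_right h2 (by positivity)
  have h5 : ((P.filter fun a => N a ≤ η * muG B ^ (1 / p)).card : ℝ) +
      ((P.filter fun a => ¬ N a ≤ η * muG B ^ (1 / p)).card : ℝ) = (A.card : ℝ) ^ n := by
    rw [← Nat.cast_add, hcard, hP, Nat.cast_pow]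
  linarith

/-- A large subset of `S` whose differences are almost-periods of `μ_A * 1_B`. -/
lemma exists_almost_periods [DecidableEq G] {p η K : ℝ} {n : ℕ} {A B S : Finset G}
    (hA : A.Nonempty) (hB : B.Nonempty) (hS : S.Nonempty) (hp : 2 ≤ p) (hη0 : 0 < η)
    (hη1 : η ≤ 1) (hn : 32 * p / η ^ 2 ≤ n) (hAS : ((A + S).card : ℝ) ≤ K * A.card) :
    ∃ T : Finset G, T.Nonempty ∧ (S.card : ℝ) ≤ 2 * K ^ n * T.card ∧
      ∀ s ∈ T, ∀ t ∈ T, lpNorm p (fun x => conv (muInd A) (ind B) (x + (s - t)) -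
        conv (muInd A) (ind B) x) ≤ 2 * (η * muG B ^ (1 / p)) := by
  set F := conv (muInd A) (ind B)
  have hA0 : (0 : ℝ) < A.card := by exact_mod_cast hA.card_pos
  have hS0 : (0 : ℝ) < S.card := by exact_mod_cast hS.card_pos
  set L := (Fintype.piFinset (fun _ : Fin n => A)).filter fun a =>
      lpNorm p (fun x => sampleMean B a x - F x) ≤ η * muG B ^ (1 / p) with hL
  have hLcard : (A.card : ℝ) ^ n ≤ 2 * L.card :=
    card_pow_le_two_mul_card_filter hA hB hp hη0 hη1 hn
  set Q := Fintype.piFinset (fun _ : Fin n => A + S)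
  -- Diagonal shifts of good tuples all land in `(A + S)^n`, so some `z` has many preimages; each is
  -- determined by its shift.
  let φ : (Fin n → G) × G → (Fin n → G) := fun w i => w.1 i + w.2
  have hmaps : ∀ w ∈ L ×ˢ S, φ w ∈ Q := by
    intro w hw
    obtain ⟨h1, h2⟩ := Finset.mem_product.1 hw
    exact Fintype.mem_piFinset.2 fun i => Finset.add_mem_add
      (Fintype.mem_piFinset.1 (Finset.mem_filter.1 h1).1 i) h2
  have hQ : Q.Nonempty := Fintype.piFinset_nonempty.2 fun _ => hA.add hS
  have hQ0 : (0 : ℝ) < Q.card := by exact_mod_cast hQ.card_pos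
  obtain ⟨z, -, hz⟩ := Finset.exists_le_card_fiber_of_nsmul_le_card_of_maps_to hmaps hQ
    (b := (L.card * S.card : ℝ) / Q.card) (by
      rw [nsmul_eq_mul, Finset.card_product, Nat.cast_mul]
      exact (mul_div_cancel₀ _ hQ0.ne').le)
  let T := S.filter fun s => (fun i => z i - s) ∈ L
  have hTfib : ((L ×ˢ S).filter fun w => φ w = z).card ≤ T.card := by
    have hz' : ∀ w ∈ (L ×ˢ S).filter (fun w => φ w = z), w.1 = fun i => z i - w.2 := by
      intro w hw
      rw [← (Finset.mem_filter.1 hw).2]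
      funext i
      simp [φ]
    refine Finset.card_le_card_of_injOn Prod.snd (fun w hw => ?_) fun w hw w' hw' h => ?_
    · have h1 := hz' w hw
      obtain ⟨h2, h3⟩ := Finset.mem_product.1 (Finset.mem_filter.1 hw).1
      exact Finset.mem_coe.2 (Finset.mem_filter.2 ⟨h3, h1 ▸ h2⟩)
    · refine Prod.ext ?_ h
      rw [hz' w hw, hz' w' hw', h]
  have hcount : (L.card : ℝ) * S.card ≤ Q.card * T.card := by
    rw [div_le_iff₀ hQ0] at hz
    have : (((L ×ˢ S).filter fun w => φ w = z).card : ℝ) ≤ T.card := by exact_mod_cast hTfib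
    nlinarith
  have hQc : (Q.card : ℝ) ≤ K ^ n * A.card ^ n := by
    rw [← mul_pow]
    simp only [Q, Fintype.card_piFinset_const, Nat.cast_pow]
    gcongr
  have hSc : (S.card : ℝ) ≤ 2 * K ^ n * T.card := by
    have h1 : (A.card : ℝ) ^ n * S.card ≤ A.card ^ n * (2 * K ^ n * T.card) := by
      calc (A.card : ℝ) ^ n * S.card ≤ 2 * L.card * S.card := by gcongr
        _ = 2 * (L.card * S.card) := by ring
        _ ≤ 2 * (Q.card * T.card) := by gcongr
        _ ≤ 2 * (K ^ n * A.card ^ n * T.card) := by gcongr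
        _ = _ := by ring
    exact le_of_mul_le_mul_left h1 (by positivity)
  -- Shifting the tuple translates its sample mean, so every F(· - s) with `s ∈ T` is close to the
  -- same function.
  have hclose : ∀ s ∈ T, lpNorm p (fun x => sampleMean B z x - F (x - s)) ≤
      η * muG B ^ (1 / p) := by
    intro s hs
    have h1 := (Finset.mem_filter.1 (Finset.mem_filter.1 hs).2).2
    rw [← lpNorm_translate p (-s)] at h1
    refine le_of_eq_of_le (congrArg _ ?_) h1
    funext x
    simp only [sampleMean, ← sub_eq_add_neg, sub_sub_sub_cancel_right]
  refine ⟨T, ?_, hSc, fun s hs t ht => ?_⟩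
  · rw [Finset.nonempty_iff_ne_empty]
    intro h
    rw [h] at hSc
    simp at hSc
    exact hS.ne_empty hSc
  · rw [← lpNorm_translate p (-s)]
    have h1 := lpNorm_sub_le (p := p) (by linarith) (fun x => F (x - t)) (sampleMean B z)
      (fun x => F (x - s))
    rw [lpNorm_sub_rev p (fun x => F (x - t)) (sampleMean B z)] at h1
    have h2 := hclose s hs
    have h3 := hclose t ht
    have e : (fun x => F (x + -s + (s - t)) - F (x + -s)) = fun x => F (x - t) - F (x - s) := by
      funext x
      congr 2 <;> abel
    rw [e]
    linarith

/-! ### Almost-periodicity on Bohr sets -/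

lemma lpNorm_ind_le {p : ℝ} (hp : 0 < p) (A : Finset G) : lpNorm p (ind A) ≤ muG A ^ (1 / p) := by
  have := lpNorm_le_of_support hp (f := ind A) A zero_le_one (fun x hx => by simp [ind, hx])
    (fun x hx => by simp [ind, hx])
  rwa [one_mul] at this

lemma conv_muInd_ind_eq_zero [DecidableEq G] {A B : Finset G} {x : G} (hx : x ∉ A + B) :
    conv (muInd A) (ind B) x = 0 := by
  rw [conv_muInd_apply, Finset.sum_eq_zero, zero_div]
  intro a ha
  have : x - a ∉ B := fun h => hx (Finset.mem_add.2 ⟨a, ha, x - a, h, add_sub_cancel a x⟩)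
  simp [ind, this]

lemma conv_comm (f g : G → ℂ) : conv f g = conv g f := by
  funext x
  rw [conv_eq_sum, conv_eq_sum]
  simp_rw [mul_comm (coef f _)]

/-- Exchanging the roles of the sets displays F as μ(B)/μ(A) times an average of translates of 1_A.
-/
lemma conv_muInd_ind_eq_mul {A B : Finset G} (hB : B.Nonempty) (x : G) :
    conv (muInd A) (ind B) x =
      ((muG B / muG A : ℝ) : ℂ) * ((B.card : ℂ)⁻¹ * ∑ b ∈ B, ind A (x - b)) := by
  have hB0 : (muG B : ℂ) ≠ 0 := by exact_mod_cast (muG_pos hB).ne'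
  have h1 : conv (muInd A) (ind B) x = conv (ind A) (ind B) x / muG A := by
    simp only [conv, muInd, div_mul_eq_mul_div, ← Finset.sum_div]
    rw [div_right_comm]
  have h2 : conv (muInd B) (ind A) x = conv (ind B) (ind A) x / muG B := by
    simp only [conv, muInd, div_mul_eq_mul_div, ← Finset.sum_div]
    rw [div_right_comm]
  have h3 := conv_muInd_apply (A := B) (ind A) x
  rw [h2, conv_comm, div_eq_iff hB0] at h3
  rw [h1, h3]
  push_cast
  ring

/-- If `A` is much larger than `B`, then `μ_A * 1_B` itself has small norm. -/
lemma lpNorm_conv_muInd_ind_le {p : ℝ} (hp : 2 ≤ p) {A B : Finset G} (hA : A.Nonempty)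
    (hB : B.Nonempty) (hBA : muG B ≤ muG A) :
    lpNorm p (conv (muInd A) (ind B)) ≤ Real.sqrt (muG B / muG A) * muG B ^ (1 / p) := by
  have hp0 : 0 < p := by linarith
  have hA0 := muG_pos hA
  have hB0 := muG_pos hB
  have hc : (B.card : ℝ) ≠ 0 := by exact_mod_cast hB.card_pos.ne'
  have e : conv (muInd A) (ind B) = fun x =>
      ((muG B / muG A : ℝ) : ℂ) * ((B.card : ℂ)⁻¹ * ∑ b ∈ B, ind A (x - b)) :=
    funext (conv_muInd_ind_eq_mul hB)
  have h1 : lpNorm p (fun x => ∑ b ∈ B, ind A (x - b)) ≤ B.card * muG A ^ (1 / p) := by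
    refine (lpNorm_sum_le (by linarith) B (fun b x => ind A (x - b))).trans ?_
    calc _ ≤ ∑ b ∈ B, muG A ^ (1 / p) := by
          gcongr with b
          simp_rw [sub_eq_add_neg]
          rw [lpNorm_translate]
          exact lpNorm_ind_le hp0 A
      _ = _ := by simp
  rw [e, lpNorm_const_mul hp0, lpNorm_const_mul hp0, Complex.norm_real,
    Real.norm_of_nonneg (by positivity), norm_inv, Complex.norm_natCast]
  set r := muG B / muG A with hr
  have hr0 : 0 < r := by positivity
  have hr1 : r ≤ 1 := div_le_one_of_le₀ hBA hA0.le
  calc r * ((B.card : ℝ)⁻¹ * lpNorm p fun x => ∑ b ∈ B, ind A (x - b))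
      ≤ r * ((B.card : ℝ)⁻¹ * (B.card * muG A ^ (1 / p))) := by gcongr
    _ = r * muG A ^ (1 / p) := by rw [inv_mul_cancel_left₀ hc]
    -- As `r ≤ 1` and `p ≥ 2`, the exponent `1 - 1 / p` may be lowered to `1 / 2`.
    _ = r ^ (1 - 1 / p) * muG B ^ (1 / p) := by
      have : muG A = muG B / r := by rw [hr]; field_simp
      rw [this, Real.div_rpow hB0.le hr0.le, Real.rpow_sub hr0, Real.rpow_one]
      ring
    _ ≤ r ^ (1 / 2 : ℝ) * muG B ^ (1 / p) := by
      refine mul_le_mul_of_nonneg_right ?_ (by positivity)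
      refine Real.rpow_le_rpow_of_exponent_ge hr0 hr1 ?_
      have : 1 / p ≤ 1 / 2 := one_div_le_one_div_of_le (by norm_num) hp
      linarith
    _ = _ := by rw [Real.sqrt_eq_rpow]

lemma lpNorm_translate_sub_le_of_large {p ε : ℝ} (hp : 2 ≤ p) (hε : 0 < ε) (hε1 : ε < 1)
    {A B : Finset G} (hA : A.Nonempty) (hB : B.Nonempty)
    (h : 2 ≤ ε * Real.sqrt (muG A / muG B)) (t : G) :
    lpNorm p (fun x => conv (muInd A) (ind B) (x + t) - conv (muInd A) (ind B) x) ≤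
      ε * muG B ^ (1 / p) := by
  have hA0 := muG_pos hA
  have hB0 := muG_pos hB
  set F := conv (muInd A) (ind B)
  have hsq : Real.sqrt (muG B / muG A) * Real.sqrt (muG A / muG B) = 1 := by
    rw [← Real.sqrt_mul (by positivity), div_mul_div_cancel₀ hA0.ne', div_self hB0.ne',
      Real.sqrt_one]
  have hu : 1 ≤ Real.sqrt (muG A / muG B) := by
    nlinarith [Real.sqrt_nonneg (muG A / muG B)]
  have hBA : muG B ≤ muG A := (one_le_div hB0).1 (Real.one_le_sqrt.1 hu)
  have hv : Real.sqrt (muG B / muG A) ≤ ε / 2 := by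
    nlinarith [Real.sqrt_nonneg (muG B / muG A)]
  have h1 := lpNorm_conv_muInd_ind_le hp hA hB hBA
  have h2 := lpNorm_sub_le (p := p) (by linarith) (fun x => F (x + t)) (fun _ => 0) F
  simp only [sub_zero] at h2
  rw [lpNorm_translate, lpNorm_sub_rev p (fun _ => 0) F] at h2
  simp only [sub_zero] at h2
  have h3 : Real.sqrt (muG B / muG A) * muG B ^ (1 / p) ≤ ε / 2 * muG B ^ (1 / p) := by gcongr
  linarith

lemma lpNorm_translate_sub_le_of_bohr [DecidableEq G] {p ε K δ : ℝ} (hp : 2 ≤ p)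
    {A B T : Finset G} (hA : A.Nonempty) (hB : B.Nonempty)
    (hAB : ((A + B).card : ℝ) ≤ K * B.card) (hK : 1 ≤ K)
    (hδ : 6 * δ * Real.sqrt (muG B / muG A) * K ^ (1 / p) ≤ ε / 3) {k : ℕ} (hδ0 : 0 ≤ δ)
    (hk : (1 / 4) ^ k ≤ δ)
    (hU : lpNorm p (fun x => (smooth T)^[k] (conv (muInd A) (ind B)) x -
      conv (muInd A) (ind B) x) ≤ ε / 3 * muG B ^ (1 / p)) {t : G}
    (ht : ∀ γ : AddChar G ℂ, 1 / 2 ≤ ‖charMean T γ‖ → ‖γ t - 1‖ ≤ δ) :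
    lpNorm p (fun x => conv (muInd A) (ind B) (x + t) - conv (muInd A) (ind B) x) ≤
      ε * muG B ^ (1 / p) := by
  have hp0 : 0 < p := by linarith
  have hp1 : 1 ≤ p := by linarith
  have hA0 := muG_pos hA
  have hB0 := muG_pos hB
  have hT := norm_smooth_iterate_translate_sub_le hA B T k hδ0 ht
  have hsupp : ∀ x ∉ A + B, conv (muInd A) (ind B) x = 0 :=
    fun _ hx => conv_muInd_ind_eq_zero hx
  set F := conv (muInd A) (ind B)
  set U := (smooth T)^[k] F
  set E := (A + B) ∪ (A + B).image (· - t)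
  have hE : muG E ≤ 2 * K * muG B := by
    have h1 : (E.card : ℝ) ≤ 2 * (K * B.card) := by
      have : E.card ≤ (A + B).card + (A + B).card :=
        (Finset.card_union_le _ _).trans (Nat.add_le_add_left Finset.card_image_le _)
      have h2 : (E.card : ℝ) ≤ (A + B).card + (A + B).card := by exact_mod_cast this
      linarith
    unfold muG
    calc (E.card : ℝ) / Fintype.card G ≤ 2 * (K * B.card) / Fintype.card G := by gcongr
      _ = _ := by ring
  have hFE : ∀ x ∉ E, F (x + t) - F x = 0 := by
    intro x hx
    obtain ⟨h1, h2⟩ := not_or.1 fun h => hx ((Finset.mem_union (s := A + B)).2 h)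
    rw [hsupp x h1, hsupp (x + t) fun h => h2 (Finset.mem_image.2 ⟨_, h, by simp⟩), sub_zero]
  -- The increment of `U` is cut off to `E`. The increment of `F` vanishes off `E`, so the cut-off
  -- only decreases its distance to that of `F`, while `V` has small support.
  let V : G → ℂ := fun x => if x ∈ E then U (x + t) - U x else 0
  have hV : lpNorm p V ≤ ε / 3 * muG B ^ (1 / p) := by
    -- Here 3δ bounds `δ + 2 * (1 / 4) ^ k`.
    have h1 : lpNorm p V ≤ (3 * δ * Real.sqrt (muG B / muG A)) * muG E ^ (1 / p) := by
      refine lpNorm_le_of_support hp0 E (by positivity) (fun x hx => ?_) fun x hx => ?_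
      · simp only [V, if_pos hx]
        refine (hT x).trans ?_
        gcongr
        linarith
      · simp [V, hx]
    have h2 : muG E ^ (1 / p) ≤ 2 * K ^ (1 / p) * muG B ^ (1 / p) := by
      calc muG E ^ (1 / p) ≤ (2 * K * muG B) ^ (1 / p) := by
            gcongr
            exact div_nonneg (Nat.cast_nonneg _) (Nat.cast_nonneg _)
        _ = 2 ^ (1 / p) * K ^ (1 / p) * muG B ^ (1 / p) := by
            rw [Real.mul_rpow (by positivity) hB0.le, Real.mul_rpow (by norm_num) (by positivity)]
        _ ≤ _ := by
            gcongr
            calc (2 : ℝ) ^ (1 / p) ≤ 2 ^ (1 : ℝ) :=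
                  Real.rpow_le_rpow_of_exponent_le (by norm_num)
                    (div_le_one_of_le₀ hp1 hp0.le)
              _ = 2 := Real.rpow_one 2
    calc lpNorm p V ≤ (3 * δ * Real.sqrt (muG B / muG A)) *
          (2 * K ^ (1 / p) * muG B ^ (1 / p)) := h1.trans (by gcongr)
      _ = 6 * δ * Real.sqrt (muG B / muG A) * K ^ (1 / p) * muG B ^ (1 / p) := by ring
      _ ≤ _ := by gcongr
  have hW : lpNorm p (fun x => (F (x + t) - F x) - V x) ≤
      lpNorm p (fun x => (F (x + t) - F x) - (U (x + t) - U x)) := by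
    refine lpNorm_mono hp0 fun x => ?_
    by_cases hx : x ∈ E
    · simp [V, hx]
    · simp only [V, hFE x hx, if_neg hx, sub_zero, norm_zero]
      exact norm_nonneg _
  have hZ : lpNorm p (fun x => (F (x + t) - F x) - (U (x + t) - U x)) ≤
      2 * (ε / 3 * muG B ^ (1 / p)) := by
    have h1 := lpNorm_sub_le hp1 (fun x => U x - F x) (fun _ => 0)
      (fun x => U (x + t) - F (x + t))
    rw [lpNorm_sub_rev p (fun _ => 0)] at h1
    simp only [sub_zero] at h1
    rw [lpNorm_translate p t (fun x => U x - F x)] at h1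
    have e : (fun x => (F (x + t) - F x) - (U (x + t) - U x)) =
        fun x => U x - F x - (U (x + t) - F (x + t)) := by
      funext x; ring
    rw [e]
    linarith
  have h1 := lpNorm_add_le hp1 (fun x => (F (x + t) - F x) - V x) V
  simp only [sub_add_cancel] at h1
  linarith

/-- Fixes the constant C: `k ≤ L + 1 ≤ 3 * L` and 32 · 36 = 1152, so the rounded-up `n` costs at
most 1153 · 9 = 10377, and 8 · 10377 < 100000. -/
lemma rank_bound {p ε K L m : ℝ} {k n : ℕ} (hp : 2 ≤ p) (hε : 0 < ε) (hε1 : ε < 1)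
    (hL : 1 / 2 ≤ L) (hk0 : 1 ≤ k) (hk : (k : ℝ) ≤ L + 1)
    (hn : (n : ℝ) ≤ 32 * p / (ε / (6 * k)) ^ 2 + 1) (hK : 0 ≤ K) (hm : 0 ≤ m) :
    8 * (m + n * K) ≤ 100000 * p * L ^ 2 * ε⁻¹ ^ 2 * K + 100000 * m := by
  have hk0' : (1 : ℝ) ≤ k := by exact_mod_cast hk0
  have hε2 : 1 ≤ ε⁻¹ ^ 2 := one_le_pow₀ ((one_le_inv₀ hε).2 hε1.le)
  have e : 32 * p / (ε / (6 * k)) ^ 2 = 1152 * (p * k ^ 2 * ε⁻¹ ^ 2) := by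
    field_simp; ring
  have h1 : (1 : ℝ) ≤ p * k ^ 2 * ε⁻¹ ^ 2 :=
    one_le_mul_of_one_le_of_one_le (one_le_mul_of_one_le_of_one_le (by linarith)
      (one_le_pow₀ hk0')) hε2
  have h2 : p * (k : ℝ) ^ 2 * ε⁻¹ ^ 2 ≤ p * (3 * L) ^ 2 * ε⁻¹ ^ 2 := by
    gcongr
    linarith
  have h3 : (n : ℝ) ≤ 10377 * (p * L ^ 2 * ε⁻¹ ^ 2) := by
    rw [e] at hn
    nlinarith
  have h4 : (n : ℝ) * K ≤ 10377 * (p * L ^ 2 * ε⁻¹ ^ 2) * K := by gcongr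
  have h5 : 0 ≤ p * L ^ 2 * ε⁻¹ ^ 2 * K := by positivity
  nlinarith

end AlmostPeriod

end

/-! ### Choice of parameters and conclusion -/

open AlmostPeriod in
theorem theorem7p3 :
    ∃ C c : ℝ, 0 < C ∧ 0 < c ∧
      ∀ (G : Type*) [AddCommGroup G] [Fintype G] [DecidableEq G]
        (p ε K₁ K₂ : ℝ) (A B S : Finset G),
        2 ≤ p → 0 < ε → ε < 1 →
        A.Nonempty → B.Nonempty → S.Nonempty →
        ((A + S).card : ℝ) ≤ K₁ * (A.card : ℝ) →
        ((A + B).card : ℝ) ≤ K₂ * (B.card : ℝ) →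
        ∀ δ d : ℝ,
          δ = c * ε * Real.sqrt (muG A / muG B) * K₂ ^ (-1 / p) →
          d = C * p * (Real.log (1 / δ)) ^ 2 * ε⁻¹ ^ 2 * Real.log (2 * K₁)
                + C * Real.log ((muG S)⁻¹) →
          ∃ (Γ : Finset (AddChar G ℂ)) (ρ : ℝ),
            (Γ.card : ℝ) ≤ d ∧ 0 ≤ ρ ∧ δ / d ≤ ρ ∧
            ∀ t ∈ bohrSet Γ ρ,
              lpNorm p (fun x => conv (muInd A) (ind B) (x + t) - conv (muInd A) (ind B) x)
                ≤ ε * muG B ^ (1 / p) := by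
  refine ⟨100000, 1 / 20, by norm_num, by norm_num, ?_⟩
  intro G _ _ _ p ε K₁ K₂ A B S hp hε hε1 hA hB hS hAS hAB δ d hδ hd
  have hp0 : 0 < p := by linarith
  have hA0 := muG_pos hA
  have hB0 := muG_pos hB
  have hS0 := muG_pos hS
  have hAc : (0 : ℝ) < A.card := by exact_mod_cast hA.card_pos
  have hBc : (0 : ℝ) < B.card := by exact_mod_cast hB.card_pos
  have hSc : (0 : ℝ) < S.card := by exact_mod_cast hS.card_pos
  have hGc : (0 : ℝ) < Fintype.card G := by exact_mod_cast Fintype.card_pos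
  have hK₁ : 1 ≤ K₁ := by
    have h1 : (A.card : ℝ) ≤ (A + S).card := by exact_mod_cast Finset.card_le_card_add_right hS
    nlinarith
  have hK₂ : 1 ≤ K₂ := by
    have h1 : (B.card : ℝ) ≤ (A + B).card := by exact_mod_cast Finset.card_le_card_add_left hA
    nlinarith
  have hlogK : 0 < Real.log (2 * K₁) := Real.log_pos (by linarith)
  have hlogS : 0 ≤ Real.log ((muG S)⁻¹) := by
    refine Real.log_nonneg ((one_le_inv₀ hS0).2 (div_le_one_of_le₀ ?_ hGc.le))
    exact_mod_cast Finset.card_le_univ S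
  have hδ0 : 0 < δ := by rw [hδ]; positivity
  have hKp : K₂ ^ (-1 / p) ≤ 1 := Real.rpow_le_one_of_one_le_of_nonpos hK₂ (by
    rw [neg_div]; linarith [one_div_pos.2 hp0])
  rcases le_or_gt (1 / 2) δ with hlarge | hsmall
  · have hd0 : 0 ≤ d := by rw [hd]; positivity
    -- Here `d` can vanish (δ = 1, S = G); then `δ / d = 0` and the radius condition is void.
    refine ⟨∅, δ / d, by simpa using hd0, by positivity, le_rfl, fun t _ =>
      lpNorm_translate_sub_le_of_large hp hε hε1 hA hB ?_ t⟩
    have h1 : δ ≤ 1 / 20 * ε * Real.sqrt (muG A / muG B) * 1 := by rw [hδ]; gcongr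
    linarith
  · set L := Real.log (1 / δ) with hLdef
    have hL : 1 / 2 ≤ L := by
      have h1 : Real.log 2 ≤ L := by
        refine Real.log_le_log (by norm_num) ?_
        rw [le_div_iff₀ hδ0]; linarith
      linarith [Real.log_two_gt_d9]
    have hd0 : 0 < d := by rw [hd]; positivity
    -- The least `k` with `exp (-k) ≤ δ`, whence also `(1 / 4) ^ k ≤ δ`.
    obtain ⟨k, hk⟩ : ∃ k : ℕ, k = ⌈L⌉₊ := ⟨_, rfl⟩
    have hLk : L ≤ k := hk ▸ Nat.le_ceil L
    have hk0 : 1 ≤ k := by rw [hk, Nat.one_le_ceil_iff]; linarith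
    have hk0' : (1 : ℝ) ≤ k := by exact_mod_cast hk0
    have hk1 : (k : ℝ) ≤ L + 1 := hk ▸ (Nat.ceil_lt_add_one (by linarith)).le
    have hkδ : (1 / 4 : ℝ) ^ k ≤ δ := by
      have h1 : (1 / 4 : ℝ) ≤ Real.exp (-1) := by
        rw [Real.exp_neg, ← one_div]
        gcongr
        linarith [Real.exp_one_lt_d9]
      calc (1 / 4 : ℝ) ^ k ≤ Real.exp (-1) ^ k := by gcongr
        _ = Real.exp (-k) := by rw [← Real.exp_nat_mul]; ring_nf
        _ ≤ Real.exp (-L) := by gcongr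
        _ = δ := by rw [hLdef, one_div, Real.log_inv, neg_neg, Real.exp_log hδ0]
    -- With η = ε/(6k), each of the `k` smoothings costs 2η μ(B)^{1/p}, in total (ε/3) μ(B)^{1/p}.
    obtain ⟨n, hn⟩ : ∃ n : ℕ, n = ⌈32 * p / (ε / (6 * k)) ^ 2⌉₊ := ⟨_, rfl⟩
    have hn1 : 32 * p / (ε / (6 * k)) ^ 2 ≤ n := hn ▸ Nat.le_ceil _
    have hn2 : (n : ℝ) ≤ 32 * p / (ε / (6 * k)) ^ 2 + 1 :=
      hn ▸ (Nat.ceil_lt_add_one (by positivity)).le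
    have hn0 : n ≠ 0 := by
      rintro rfl
      have : 0 < 32 * p / (ε / (6 * k)) ^ 2 := by positivity
      push_cast at hn1
      linarith
    obtain ⟨T, hT, hST, hTper⟩ := exists_almost_periods hA hB hS hp
      (η := ε / (6 * k)) (by positivity) (div_le_one_of_le₀ (by linarith) (by positivity)) hn1 hAS
    obtain ⟨Γ, hΓ, hbohr⟩ := exists_finset_spectrum hT
    have hTc : (0 : ℝ) < T.card := by exact_mod_cast hT.card_pos
    have hlogT : Real.log (muG T)⁻¹ ≤ Real.log (muG S)⁻¹ + n * Real.log (2 * K₁) := by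
      rw [← Real.log_pow, ← Real.log_mul (by positivity) (by positivity)]
      refine Real.log_le_log (inv_pos.2 (muG_pos hT)) ?_
      -- The factor 2 lost to the bad tuples is absorbed because `n ≥ 1`.
      have h2 : 2 * K₁ ^ n ≤ (2 * K₁) ^ n := by
        rw [mul_pow]
        gcongr
        exact le_self_pow₀ (by norm_num) hn0
      have h3 : (S.card : ℝ) ≤ (2 * K₁) ^ n * T.card := hST.trans (by gcongr)
      rw [muG, muG, inv_div, inv_div, div_le_iff₀ hTc, div_mul_eq_mul_div, div_mul_eq_mul_div,
        le_div_iff₀ hSc, mul_assoc]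
      gcongr
    have hΓd : (Γ.card : ℝ) ≤ d := by
      rw [hd]
      refine hΓ.trans (le_trans (by gcongr) (rank_bound hp hε hε1 hL hk0 hk1 hn2 hlogK.le hlogS))
    refine ⟨Γ, δ / d, hΓd, by positivity, le_rfl, fun t ht => ?_⟩
    refine lpNorm_translate_sub_le_of_bohr (T := T) (K := K₂) (k := k) (δ := δ) hp hA hB hAB hK₂
      ?_ hδ0.le hkδ ?_ fun γ hγ => ?_
    · have h1 : Real.sqrt (muG A / muG B) * Real.sqrt (muG B / muG A) = 1 := by
        rw [← Real.sqrt_mul (by positivity), div_mul_div_cancel₀ hB0.ne', div_self hA0.ne',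
          Real.sqrt_one]
      have h2 : K₂ ^ (-1 / p) * K₂ ^ (1 / p) = 1 := by
        rw [← Real.rpow_add (by linarith), neg_div, neg_add_cancel, Real.rpow_zero]
      -- The definition of δ cancels both factors, leaving 6/20 ≤ 1/3: hence c = 1/20.
      have h3 : 6 * δ * Real.sqrt (muG B / muG A) * K₂ ^ (1 / p) =
          6 / 20 * ε * (Real.sqrt (muG A / muG B) * Real.sqrt (muG B / muG A)) *
            (K₂ ^ (-1 / p) * K₂ ^ (1 / p)) := by
        rw [hδ]; ring
      rw [h3, h1, h2]
      linarith
    · refine (lpNorm_smooth_iterate_sub_le (by linarith) hT _ hTper k).trans (le_of_eq ?_)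
      field_simp
      ring
    · refine (hbohr _ t ht γ hγ).trans ?_
      calc (Γ.card : ℝ) * (δ / d) ≤ d * (δ / d) := by gcongr
        _ = δ := mul_div_cancel₀ _ hd0.ne'
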